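/- **Setting.** Let $\mathcal E$ be a finite-dimensional real inner product space with norm $\|\cdot\|$. Let $f:\mathcal E\to(-\infty,\infty]$ be convex and lower semicontinuous, with $\mathrm{dom}(f)=\{x: f(x)<\infty\}$ and $\mathrm{epi}(f)=\{(x,t)\in\mathcal E\times\mathbb R: f(x)\le t\}$. Let $S\subseteq\mathcal E$ be closed and convex, let $A$ be a linear map on $\mathcal E$, let $b$ be a vector, and let $\mathrm{Feas}=\{x\in S: Ax=b\}$. Let $\bar e\in\mathrm{int}(S\cap\mathrm{dom}(f))$ with $A\bar e=b$, let $\hat f\in\mathbb R$ with $\hat f>f(\bar e)$, and let $0<\epsilon<1$. Put $$\bar D=\mathrm{diam}\{x\in\mathrm{Feas}: f(x)\le f(\bar e)\},\qquad \hat r=\sup\{r\ge 0:\ \|x-\bar e\|\le r,\ Ax=b\ \Rightarrow\ x\in S,\ f(x)\le\hat f\},$$ and assume $\bar D<\infty$. If $\hat r=\infty$, read $\bar D/\hat r$ as $0$. No Lipschitz assumption is made on $f$. **Line search.** For $x\in\mathcal E$ and $t,\alpha\in\mathbb R$ let $x(\alpha)=\bar e+\alpha(x-\bar e)$ and $t(\alpha)=\hat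 f+\alpha(t-\hat f)$. Let $$\alpha(x,t)=\min\big\{\sup\{\alpha: x(\alpha)\in S\},\ \sup\{\alpha: f(x(\alpha))\le t(\alpha)\}\big\},\qquad \pi'(x,t)=\big(x(\alpha),t(\alpha)\big)\ \text{ at }\ \alpha=\alpha(x,t).$$ **Directions.** Let $N_C(p)$ denote the normal cone of $C$ at $p$, where $\mathcal E\times\mathbb R$ has the inner product $\langle x_1,x_2\rangle+t_1t_2$. Let $$G_1(x')=\Big\{\tfrac{-1}{\langle v,\bar e-x'\rangle}v:\ 0\ne v\in N_S(x')\Big\},\qquad G_2(x',t')=\Big\{\tfrac{-1}{\langle v,\bar e-x'\rangle+(\hat f-t')\delta}v:\ 0\ne(v,\delta)\in N_{\mathrm{epi}(f)}(x',t')\Big\}.$$ Define $G(x',t')$ as $G_1(x')$ if $x'\in\mathrm{bdy}(S)$ and $(x',t')\notin\mathrm{bdy}(\mathrm{epi}(f))$; as $G_2(x',t')$ if $x'\notin\mathrm{bdy}(S)$ and $(x',t')\in\mathrm{bdy}(\mathrm{epi}(f))$; and as the convex hull of $G_1(x')\cup G_2(x',t')$ if both boundary conditions hold. Let $P$ be the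 orthogonal projection of $\mathcal E$ onto $\ker A$. **Algorithm A.** Start with $(x_0,t_0)=(x_0',t_0')=(\bar e,f(\bar e))$. For $k=0,1,2,\dots$ choose any $g'\in G(x_k',t_k')$ and set $$\tilde x_{k+1}=x_k-\frac{\epsilon}{2\|P(g')\|^2}P(g')\quad(\tilde x_{k+1}=x_k\text{ if }P(g')=0),\qquad \alpha_{k+1}=\alpha(\tilde x_{k+1},t_k),\qquad (x_{k+1}',t_{k+1}')=\pi'(\tilde x_{k+1},t_k).$$ If $\alpha_{k+1}\ge 4/3$, let $(x_{k+1},t_{k+1})=(x_{k+1}',t_{k+1}')$; otherwise let $(x_{k+1},t_{k+1})=(\tilde x_{k+1},t_k)$. **Theorem.** Algorithm A can be run: there is an infinite sequence of iterates that it generates. The minimum $f^*$ of $f$ over $\mathrm{Feas}$ is attained and finite. For every sequence of iterates generated by Algorithm A, whatever the choices of $g'$, each $x_k'$ lies in $\mathrm{Feas}\cap\mathrm{dom}(f)$, and for every integer $\ell\ge 0$, $$\ell\ \ge\ 8\Big(\frac{\bar D}{\hat r}\Big)^2\Big(\frac1{\epsilon^2}+\frac1\epsilon\log_{4/3}\Big(1+\frac{\bar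 D}{\hat r}\Big)\Big)\quad\Longrightarrow\quad \min_{k\le\ell}\ \frac{f(x_k')-f^*}{\hat f-f^*}\ \le\ \epsilon .$$ -/

import Mathlib

open scoped InnerProductSpace ENNReal

noncomputable section

namespace SubgradA

/-- The data of the problem `min f(x)` subject to `x ∈ S`, `A x = b`, together with the inputs
`ebar` and `fhat` of the algorithm. The assumptions on these data are hypotheses of the theorem. -/
structure Data (E F : Type*) [NormedAddCommGroup E] [InnerProductSpace ℝ E]
    [AddCommGroup F] [Module ℝ F] where
  f : E → EReal
  S : Set E
  A : E →ₗ[ℝ] F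
  b : F
  ebar : E
  fhat : ℝ

/-- An iterate `(x_k, t_k)`, `(x'_k, t'_k)` of the algorithm; the primed pair is `(xp, tp)`. -/
structure State (E : Type*) where
  x : E
  t : ℝ
  xp : E
  tp : ℝ

variable {E F : Type*} [NormedAddCommGroup E] [InnerProductSpace ℝ E]
  [AddCommGroup F] [Module ℝ F]

/-- Effective domain of a function with values in `(-∞, ∞]`. -/
def dom (f : E → EReal) : Set E := {x | f x < ⊤}

/-- Epigraph. -/
def epi (f : E → EReal) : Set (E × ℝ) := {p | f p.1 ≤ (p.2 : EReal)}

/-- Normal cone of `C` at `x`. -/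
def normalCone (C : Set E) (x : E) : Set E := {v | ∀ y ∈ C, ⟪v, y - x⟫_ℝ ≤ 0}

/-- Normal cone of `C ⊆ E × ℝ` at `p`, for the inner product `⟪x₁, x₂⟫ + t₁ t₂` on pairs. -/
def normalConePair (C : Set (E × ℝ)) (p : E × ℝ) : Set (E × ℝ) :=
  {v | ∀ q ∈ C, ⟪v.1, q.1 - p.1⟫_ℝ + v.2 * (q.2 - p.2) ≤ 0}

namespace Data

variable (d : Data E F)

/-- The feasible set. -/
def Feas : Set E := {x | x ∈ d.S ∧ d.A x = d.b}

/-- The diameter of the sublevel set `{x ∈ Feas | f x ≤ f ebar}`. -/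
def Dbar : ℝ≥0∞ := Metric.ediam {x | x ∈ d.Feas ∧ d.f x ≤ d.f d.ebar}

/-- The supremum of the radii `r` of balls around `ebar` that, inside `{A x = b}`, are contained
in `S` and in the sublevel set of `f` at level `fhat`. -/
def rhat : ℝ≥0∞ :=
  sSup {r | ∃ ρ : ℝ, 0 ≤ ρ ∧ r = ENNReal.ofReal ρ ∧
    ∀ x, ‖x - d.ebar‖ ≤ ρ ∧ d.A x = d.b → x ∈ d.S ∧ d.f x ≤ (d.fhat : EReal)}

/-- The point `x(α)` of the ray. -/
def rayX (x : E) (α : ℝ) : E := d.ebar + α • (x - d.ebar)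

/-- The height `t(α)` of the ray. -/
def rayT (t α : ℝ) : ℝ := d.fhat + α * (t - d.fhat)

def alpha1 (x : E) : EReal := sSup ((fun α : ℝ => (α : EReal)) '' {α | d.rayX x α ∈ d.S})

def alpha2 (x : E) (t : ℝ) : EReal :=
  sSup ((fun α : ℝ => (α : EReal)) '' {α | d.f (d.rayX x α) ≤ (d.rayT t α : EReal)})

/-- The result of the line search. The minimum is positive and finite whenever `A x = b` and
`t < fhat`, under the assumptions of the theorem. -/
def alpha (x : E) (t : ℝ) : ℝ := (min (d.alpha1 x) (d.alpha2 x t)).toReal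

/-- The radial projection of `(x, t)` from `(ebar, fhat)`. -/
def radialProj (x : E) (t : ℝ) : E × ℝ :=
  (d.rayX x (d.alpha x t), d.rayT t (d.alpha x t))

def G1 (xp : E) : Set E :=
  {g | ∃ v ∈ normalCone d.S xp, v ≠ 0 ∧ g = (-1 / ⟪v, d.ebar - xp⟫_ℝ) • v}

def G2 (xp : E) (tp : ℝ) : Set E :=
  {g | ∃ v : E, ∃ δ : ℝ, (v, δ) ∈ normalConePair (epi d.f) (xp, tp) ∧ (v, δ) ≠ 0 ∧
    g = (-1 / (⟪v, d.ebar - xp⟫_ℝ + (d.fhat - tp) * δ)) • v}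

def bdy1 : Set (E × ℝ) := {p | p.1 ∈ frontier d.S}

def bdy2 : Set (E × ℝ) := frontier (epi d.f)

/-- The set from which the algorithm picks its direction (no choice is available outside
`bdy1 ∪ bdy2`). -/
def G (xp : E) (tp : ℝ) : Set E :=
  {g | ((xp, tp) ∈ d.bdy1 \ d.bdy2 ∧ g ∈ d.G1 xp) ∨
    ((xp, tp) ∈ d.bdy2 \ d.bdy1 ∧ g ∈ d.G2 xp tp) ∨
    ((xp, tp) ∈ d.bdy1 ∩ d.bdy2 ∧ g ∈ convexHull ℝ (d.G1 xp ∪ d.G2 xp tp))}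

/-- The initial iterate. -/
def init : State E where
  x := d.ebar
  t := (d.f d.ebar).toReal
  xp := d.ebar
  tp := (d.f d.ebar).toReal

variable [FiniteDimensional ℝ E]

/-- Orthogonal projection onto the kernel of `A`. -/
def P : E →L[ℝ] E := (LinearMap.ker d.A).starProjection

/-- The subgradient step along `g`, with no movement if `P g = 0`. -/
def xtilde (ε : ℝ) (s : State E) (g : E) : E := s.x - (ε / (2 * ‖d.P g‖ ^ 2)) • d.P g

/-- One iteration, for the chosen direction `g`. -/
def step (ε : ℝ) (s : State E) (g : E) : State E :=
  let z := d.xtilde ε s g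
  let p := d.radialProj z s.t
  if 4 / 3 ≤ d.alpha z s.t then ⟨p.1, p.2, p.1, p.2⟩ else ⟨z, s.t, p.1, p.2⟩

/-- `s` is a sequence of iterates that the algorithm can generate with accuracy parameter `ε`. -/
def IsRun (ε : ℝ) (s : ℕ → State E) : Prop :=
  s 0 = d.init ∧ ∀ k, ∃ g ∈ d.G (s k).xp (s k).tp, s (k + 1) = d.step ε (s k) g

end Data

end SubgradA

end

noncomputable section

namespace SubgradA

/-! ### Cost accounting over the phases of constant height. -/

section Potential

/-! Let D be the diameter `Dbar`, ρ an admissible inner radius, and u = (fhat - t)/(fhat - f*) the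
relative height of an iterate (x, t). The ray from (ebar, fhat) to an optimal (y, f*) crosses height
t above w = ebar + u(y - ebar), where the radial gauge 1/α is at most u. Every direction in `G` is
the x-part of a supporting hyperplane normalised to the value 1 at the primed point, so ⟨g, x - w⟩ ≥
1/α - u (`gap_le_inner`). Testing the hyperplane at height fhat on the ball of radius ρ gives ρ‖P g‖
≤ 1 (`mul_norm_P_le`); this replaces a Lipschitz bound. Since α < 4/3, a primed point that is not
ε-optimal has gap 1/α - u above 3ε/4, so the step moves x towards w by a definite amount
(`norm_step_sq_le`).

The run splits into phases on which t, and hence w, is fixed. A restart multiplies u by at least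
4/3, keeps u ≤ 1, and puts both x and the new w in the sublevel set, at distance at most D. At most
two phases have u > 9/16; each takes about (D/ρ)² · 2/ε² steps. In the lower phases the gap is also
at least a constant, which reduces this to (D/ρ)² · 8/ε. The number of phases is logarithmic in 1/u
at the start, which is at most 1 + D/ρ (`one_div_relHeight_le`). `potential` combines these counts:
it is nonnegative and falls by at least one per step before ε-optimality (`potential_step_le`). -/

/-- Weight of the normalised squared distance to the target during a phase with relative height
`u`. -/
def phaseCost (ε u : ℝ) : ℝ := if u ≤ 9 / 16 then 8 / ε else 2 / ε ^ 2

/-- Budget for the phases following one with relative height `u`. -/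
def futureCost (ε u : ℝ) : ℝ :=
  if u ≤ 9 / 16 then 4 / ε ^ 2 + 8 / ε * (Real.logb (4 / 3) (1 / u) - 1)
  else if u ≤ 3 / 4 then 2 / ε ^ 2 else 0

variable {ε u u' : ℝ}

lemma phaseCost_nonneg (hε : 0 < ε) : 0 ≤ phaseCost ε u := by
  unfold phaseCost; split_ifs <;> positivity

lemma two_le_logb_one_div (hu : 0 < u) (h : u ≤ 9 / 16) : 2 ≤ Real.logb (4 / 3) (1 / u) := by
  rw [Real.le_logb_iff_rpow_le (by norm_num) (by positivity), le_div_iff₀ hu]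
  norm_num
  linarith

lemma futureCost_nonneg (hε : 0 < ε) (hu : 0 < u) : 0 ≤ futureCost ε u := by
  unfold futureCost
  split_ifs with h
  · have := two_le_logb_one_div hu h
    have : 0 ≤ Real.logb (4 / 3) (1 / u) - 1 := by linarith
    positivity
  · positivity
  · exact le_rfl

/-- A restart is paid for by the remaining budget. Among low phases, the factor 4/3 uses up one unit
of the logarithm. As 9/16 = (3/4)², at most two later phases lie above 9/16, which accounts for 4/ε²
= 2 · 2/ε²; from above 3/4 no restart is possible. -/
lemma phaseCost_add_futureCost_le (hε : 0 < ε) (hu : 0 < u) (h : 4 / 3 * u ≤ u') (hu' : u' ≤ 1) :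
    phaseCost ε u' + futureCost ε u' ≤ futureCost ε u := by
  have e1 : 0 < 8 / ε := by positivity
  have e2 : 2 / ε ^ 2 + 2 / ε ^ 2 = 4 / ε ^ 2 := by ring
  have e3 : 0 < 2 / ε ^ 2 := by positivity
  unfold phaseCost futureCost
  by_cases h1 : u' ≤ 9 / 16
  · have h2 : u ≤ 9 / 16 := by linarith
    have hl : Real.logb (4 / 3) (1 / u') + 1 ≤ Real.logb (4 / 3) (1 / u) := by
      have hu0 : 0 < u' := by linarith
      have : Real.logb (4 / 3) (1 / u') + 1 = Real.logb (4 / 3) (1 / u' * (4 / 3)) := by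
        rw [Real.logb_mul (by positivity) (by norm_num), Real.logb_self_eq_one (by norm_num)]
      rw [this]
      apply Real.logb_le_logb_of_le (by norm_num) (by positivity)
      rw [div_mul_eq_mul_div, div_le_div_iff₀ hu0 hu]
      linarith
    simp only [h1, h2, if_true]
    nlinarith
  · by_cases h2 : u ≤ 9 / 16
    · have := two_le_logb_one_div hu h2
      simp only [h1, h2, if_true, if_false]
      have : 0 ≤ 8 / ε * (Real.logb (4 / 3) (1 / u) - 1) :=
        mul_nonneg e1.le (by linarith)
      split_ifs <;> linarith
    · have h3 : u ≤ 3 / 4 := by linarith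
      have h4 : ¬ u' ≤ 3 / 4 := by linarith
      simp [h1, h2, h3, h4]

lemma phaseCost_add_futureCost_le_total (hε : 0 < ε) (hu : 0 < u) (hu1 : u ≤ 1) :
    phaseCost ε u + futureCost ε u ≤
      8 * (1 / ε ^ 2 + 1 / ε * Real.logb (4 / 3) (1 / u)) := by
  have e3 : 0 < 1 / ε ^ 2 := by positivity
  have e2 : 2 / ε ^ 2 = 2 * (1 / ε ^ 2) := by ring
  have e4 : 4 / ε ^ 2 = 4 * (1 / ε ^ 2) := by ring
  have e8 : 8 / ε = 8 * (1 / ε) := by ring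
  have hl : 0 ≤ 1 / ε * Real.logb (4 / 3) (1 / u) :=
    mul_nonneg (by positivity) (Real.logb_nonneg (by norm_num) ((one_le_div hu).2 hu1))
  unfold phaseCost futureCost
  split_ifs <;> simp only [e2, e4, e8] <;> nlinarith

/-- The weights are chosen for this. If u ≤ 9/16, one third of the first bound plus two thirds of
the second gives gap ≥ ε/4 + 1/8; otherwise the first bound alone leaves ε²/2. -/
lemma one_le_phaseCost_mul {gap : ℝ} (hε : 0 < ε) (h1 : 3 * ε / 4 ≤ gap) (h2 : 3 / 4 - u ≤ gap) :
    1 ≤ phaseCost ε u * (ε * gap - ε ^ 2 / 4) := by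
  unfold phaseCost
  split_ifs with h
  · rw [show 8 / ε * (ε * gap - ε ^ 2 / 4) = 8 * (gap - ε / 4) by field_simp]
    linarith
  · rw [show 2 / ε ^ 2 * (ε * gap - ε ^ 2 / 4) = 2 * gap / ε - 1 / 2 by field_simp; ring]
    have : 3 / 2 ≤ 2 * gap / ε := by rw [le_div_iff₀ hε]; linarith
    linarith

/-- A subgradient step with step length `ε / (2 ‖p‖²)` along `p`, at a point whose gap to `w` is at
least `gap`, decreases the squared distance to `w`. -/
lemma norm_step_sq_le {E : Type*} [NormedAddCommGroup E] [InnerProductSpace ℝ E] {x w p : E}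
    {ρ gap : ℝ} (hε : 0 < ε) (hgap : 3 * ε / 4 ≤ gap) (hρ : 0 < ρ) (hp : ρ * ‖p‖ ≤ 1)
    (hin : gap ≤ ⟪p, x - w⟫_ℝ) :
    ‖x - (ε / (2 * ‖p‖ ^ 2)) • p - w‖ ^ 2 / ρ ^ 2 ≤
      ‖x - w‖ ^ 2 / ρ ^ 2 - (ε * gap - ε ^ 2 / 4) := by
  have hp0 : 0 < ‖p‖ := by
    rw [norm_pos_iff]
    rintro rfl
    rw [inner_zero_left] at hin
    linarith
  have hc : 0 ≤ ε * gap - ε ^ 2 / 4 := by nlinarith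
  have key : ‖x - (ε / (2 * ‖p‖ ^ 2)) • p - w‖ ^ 2 =
      ‖x - w‖ ^ 2 - (ε * ⟪p, x - w⟫_ℝ - ε ^ 2 / 4) / ‖p‖ ^ 2 := by
    rw [sub_right_comm, norm_sub_sq_real, inner_smul_right, norm_smul, Real.norm_eq_abs,
      mul_pow, sq_abs, real_inner_comm]
    field_simp
    ring
  have h1 : ε * gap - ε ^ 2 / 4 ≤ (ε * ⟪p, x - w⟫_ℝ - ε ^ 2 / 4) := by nlinarith
  have h2 : ρ ^ 2 * (ε * gap - ε ^ 2 / 4) ≤ (ε * ⟪p, x - w⟫_ℝ - ε ^ 2 / 4) / ‖p‖ ^ 2 := by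
    rw [le_div_iff₀ (by positivity)]
    have : (ρ * ‖p‖) ^ 2 ≤ 1 := pow_le_one₀ (by positivity) hp
    calc _ = (ρ * ‖p‖) ^ 2 * (ε * gap - ε ^ 2 / 4) := by ring
      _ ≤ 1 * (ε * gap - ε ^ 2 / 4) := by gcongr
      _ ≤ _ := by linarith
  rw [key, div_le_iff₀ (by positivity), sub_mul, div_mul_cancel₀ _ (by positivity)]
  linarith

end Potential

/-! ### Rays from an interior point of a set. -/

section Ray

open Topology

variable {V : Type*} [NormedAddCommGroup V] [NormedSpace ℝ V] {C : Set V} {e w : V}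

lemma eventually_ray_mem (α : ℝ) (he : e + α • w ∈ interior C) :
    ∀ᶠ β : ℝ in 𝓝 α, e + β • w ∈ C := by
  have hc : ContinuousAt (fun β : ℝ => e + β • w) α := by fun_prop
  exact hc.eventually (mem_interior_iff_mem_nhds.1 he)

/-- A nonzero functional bounded by `c` on `C` is less than `c` on the interior of `C`. -/
lemma lt_of_mem_interior_of_le (L : V →ₗ[ℝ] ℝ) (hL : L ≠ 0) {c : ℝ} (he : e ∈ interior C)
    (h : ∀ a ∈ C, L a ≤ c) : L e < c := by
  obtain ⟨w, hw⟩ : ∃ w, L w ≠ 0 := by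
    by_contra! hcon
    exact hL (LinearMap.ext hcon)
  -- Scaling w by L w makes L increase at rate (L w)², whatever the sign of L w.
  have hev := eventually_ray_mem (e := e) (w := L w • w) 0 (by simpa using he)
  obtain ⟨β, hβ, hβ0⟩ :=
    ((hev.filter_mono nhdsWithin_le_nhds).and (self_mem_nhdsWithin (s := Set.Ioi (0 : ℝ)))).exists
  have := h _ hβ
  simp only [map_add, map_smul, smul_eq_mul] at this
  have hpos : 0 < β * (L w * L w) := mul_pos hβ0 (mul_self_pos.2 hw)
  linarith

/-- The supremal parameter of the ray from `e` in direction `w` within `C`. -/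
def raySup (C : Set V) (e w : V) : EReal :=
  sSup ((fun α : ℝ => (α : EReal)) '' {α | e + α • w ∈ C})

lemma raySup_pos (he : e ∈ interior C) : 0 < raySup C e w := by
  have hev := eventually_ray_mem (e := e) (w := w) 0 (by simpa using he)
  obtain ⟨β, hβ, hβ0⟩ :=
    ((hev.filter_mono nhdsWithin_le_nhds).and (self_mem_nhdsWithin (s := Set.Ioi (0 : ℝ)))).exists
  have h0 : (0 : EReal) < (β : EReal) := by exact_mod_cast hβ0
  exact h0.trans_le (le_sSup ⟨β, hβ, rfl⟩)

lemma ray_mem_of_lt_raySup (hC : Convex ℝ C) (he : e ∈ C) {α : ℝ} (hα : 0 ≤ α)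
    (h : (α : EReal) < raySup C e w) : e + α • w ∈ C := by
  obtain ⟨_, ⟨β, hβ, rfl⟩, hlt⟩ := lt_sSup_iff.1 h
  have hlt : α < β := EReal.coe_lt_coe_iff.1 hlt
  have hβ0 : 0 < β := hα.trans_lt hlt
  have := hC he hβ (sub_nonneg.2 ((div_le_one hβ0).2 hlt.le)) (div_nonneg hα hβ0.le)
    (by ring : 1 - α / β + α / β = 1)
  convert this using 1
  rw [smul_add, smul_smul, div_mul_cancel₀ _ hβ0.ne', ← add_assoc, ← add_smul]
  simp

lemma ray_mem_of_le_raySup (hC : Convex ℝ C) (hcl : IsClosed C) (he : e ∈ C) {α : ℝ} (hα : 0 < α)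
    (h : (α : EReal) ≤ raySup C e w) : e + α • w ∈ C := by
  have hK : IsClosed {β : ℝ | e + β • w ∈ C} :=
    hcl.preimage (f := fun β : ℝ => e + β • w) (by fun_prop)
  have hsub : Set.Ico 0 α ⊆ {β : ℝ | e + β • w ∈ C} := fun β hβ =>
    ray_mem_of_lt_raySup hC he hβ.1 ((EReal.coe_lt_coe_iff.2 hβ.2).trans_le h)
  have := closure_minimal hsub hK
  rw [closure_Ico hα.ne] at this
  exact this ⟨hα.le, le_rfl⟩

lemma ray_mem_frontier (hC : Convex ℝ C) (hcl : IsClosed C) (he : e ∈ C) {α : ℝ} (hα : 0 < α)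
    (h : (α : EReal) = raySup C e w) : e + α • w ∈ frontier C := by
  rw [hcl.frontier_eq]
  refine ⟨ray_mem_of_le_raySup hC hcl he hα h.le, fun hint => ?_⟩
  obtain ⟨β, hβ, hβα⟩ := (((eventually_ray_mem α hint).filter_mono nhdsWithin_le_nhds).and
    (self_mem_nhdsWithin (s := Set.Ioi α))).exists
  have : (β : EReal) ≤ α := h ▸ le_sSup ⟨β, hβ, rfl⟩
  exact absurd (EReal.coe_le_coe_iff.1 this) (not_le.2 hβα)

end Ray

/-! ### Epigraphs and normal cones. -/

section NormalCones

lemma isClosed_epi {E : Type*} [NormedAddCommGroup E] {f : E → EReal}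
    (hf : LowerSemicontinuous f) : IsClosed (epi f) := by
  have := lowerSemicontinuous_iff_isClosed_epigraph.1 hf
  exact this.preimage (f := fun p : E × ℝ => (p.1, (p.2 : EReal)))
    (continuous_fst.prodMk (continuous_coe_real_ereal.comp continuous_snd))

lemma coe_toReal_of_mem_dom {E : Type*} {f : E → EReal} (hbot : ∀ x, f x ≠ ⊥) {x : E}
    (hx : x ∈ dom f) : ((f x).toReal : EReal) = f x :=
  EReal.coe_toReal (ne_of_lt hx) (hbot x)

variable {E : Type*} [NormedAddCommGroup E] [InnerProductSpace ℝ E]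

lemma convexOn_toReal {f : E → EReal} (hbot : ∀ x, f x ≠ ⊥) (hf : Convex ℝ (epi f)) :
    ConvexOn ℝ (dom f) (fun x => (f x).toReal) := by
  have key : ∀ x ∈ dom f, ∀ y ∈ dom f, ∀ a b : ℝ, 0 ≤ a → 0 ≤ b → a + b = 1 →
      f (a • x + b • y) ≤ ((a * (f x).toReal + b * (f y).toReal : ℝ) : EReal) := by
    intro x hx y hy a b ha hb hab
    exact hf (x := (x, (f x).toReal)) (y := (y, (f y).toReal))
      (coe_toReal_of_mem_dom hbot hx).ge (coe_toReal_of_mem_dom hbot hy).ge ha hb hab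
  refine ⟨fun x hx y hy a b ha hb hab =>
    (key x hx y hy a b ha hb hab).trans_lt (EReal.coe_lt_top _), ?_⟩
  intro x hx y hy a b ha hb hab
  have h := key x hx y hy a b ha hb hab
  rw [← coe_toReal_of_mem_dom hbot (h.trans_lt (EReal.coe_lt_top _))] at h
  exact EReal.coe_le_coe_iff.1 h

/-- A point strictly above the graph over the interior of the domain is interior to the
epigraph. -/
lemma mem_interior_epi [FiniteDimensional ℝ E] {f : E → EReal} (hbot : ∀ x, f x ≠ ⊥)
    (hf : Convex ℝ (epi f)) {x : E} {t : ℝ} (hx : x ∈ interior (dom f)) (ht : f x < t) :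
    (x, t) ∈ interior (epi f) := by
  -- In finite dimension a convex function is continuous on the interior of its domain.
  have hcont := (convexOn_toReal hbot hf).continuousOn_interior.continuousAt
    (isOpen_interior.mem_nhds hx)
  have h1 : ContinuousAt (fun p : E × ℝ => (f p.1).toReal) (x, t) :=
    ContinuousAt.comp (f := Prod.fst) (g := fun x => (f x).toReal) hcont continuousAt_fst
  have hlt : (f x).toReal < t := by
    rw [← EReal.coe_lt_coe_iff, coe_toReal_of_mem_dom hbot (interior_subset hx)]
    exact ht
  have h2 := h1.eventually_lt (continuousAt_snd (p := (x, t))) hlt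
  have h3 : ∀ᶠ p : E × ℝ in nhds (x, t), p.1 ∈ dom f :=
    continuousAt_fst.eventually (mem_interior_iff_mem_nhds.1 hx)
  rw [mem_interior_iff_mem_nhds]
  filter_upwards [h2, h3] with p hp hpd
  change f p.1 ≤ (p.2 : EReal)
  rw [← coe_toReal_of_mem_dom hbot hpd]
  exact_mod_cast hp.le

lemma exists_ne_zero_mem_normalCone [FiniteDimensional ℝ E] {C : Set E} (hC : Convex ℝ C)
    (hne : (interior C).Nonempty) {x : E} (hx : x ∉ interior C) :
    ∃ v ∈ normalCone C x, v ≠ 0 := by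
  obtain ⟨L, hL, h⟩ := geometric_hahn_banach_of_nonempty_interior_point hC hx hne
  refine ⟨(InnerProductSpace.toDual ℝ E).symm L, fun y hy => ?_, by simpa using hL⟩
  rw [InnerProductSpace.toDual_symm_apply, map_sub]
  linarith [h y hy]

lemma exists_ne_zero_mem_normalConePair [FiniteDimensional ℝ E] {C : Set (E × ℝ)}
    (hC : Convex ℝ C) (hne : (interior C).Nonempty) {p : E × ℝ} (hp : p ∉ interior C) :
    ∃ v δ, (v, δ) ∈ normalConePair C p ∧ (v, δ) ≠ 0 := by
  obtain ⟨L, hL, h⟩ := geometric_hahn_banach_of_nonempty_interior_point hC hp hne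
  obtain ⟨v, hdec⟩ : ∃ v, ∀ q : E × ℝ, L q = ⟪v, q.1⟫_ℝ + L (0, 1) * q.2 := by
    refine ⟨(InnerProductSpace.toDual ℝ E).symm (L.comp (ContinuousLinearMap.inl ℝ E ℝ)),
      fun q => ?_⟩
    rw [InnerProductSpace.toDual_symm_apply, ContinuousLinearMap.comp_apply,
      ContinuousLinearMap.inl_apply, mul_comm, ← smul_eq_mul, ← map_smul, ← map_add]
    simp
  refine ⟨v, L (0, 1), fun q hq => ?_, fun h0 => hL ?_⟩
  · have := hdec (q - p)
    rw [map_sub] at this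
    exact this ▸ (sub_nonpos.2 (h q hq))
  · rw [Prod.mk_eq_zero] at h0
    refine ContinuousLinearMap.ext fun q => ?_
    rw [hdec, h0.1, h0.2]
    simp

/-- Strictness is what makes the normalising factor in `G1` a genuine positive number; the next
lemma serves `G2` in the same way. -/
lemma inner_lt_zero_of_mem_normalCone {C : Set E} {x e v : E} (he : e ∈ interior C)
    (hv : v ∈ normalCone C x) (hv0 : v ≠ 0) : ⟪v, e - x⟫_ℝ < 0 := by
  have := lt_of_mem_interior_of_le (innerₛₗ ℝ v) (c := ⟪v, x⟫_ℝ)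
    (fun h => hv0 (by simpa using congrArg (· v) h)) he
    (fun a ha => by have := hv a ha; rw [inner_sub_right] at this; simpa using this)
  rw [inner_sub_right]
  simpa using this

lemma inner_add_lt_zero_of_mem_normalConePair {C : Set (E × ℝ)} {x e v : E} {s t δ : ℝ}
    (he : (e, s) ∈ interior C) (hv : (v, δ) ∈ normalConePair C (x, t)) (hv0 : (v, δ) ≠ 0) :
    ⟪v, e - x⟫_ℝ + (s - t) * δ < 0 := by
  have := lt_of_mem_interior_of_le
    ((innerₛₗ ℝ v).comp (LinearMap.fst ℝ E ℝ) + δ • LinearMap.snd ℝ E ℝ) (c := ⟪v, x⟫_ℝ + δ * t)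
    (fun h => hv0 (Prod.ext (by simpa using congrArg (· (v, 0)) h)
      (by simpa using congrArg (· (0, 1)) h))) he
    (fun a ha => by
      have := hv a ha
      simp only [inner_sub_right] at this
      simp
      linarith)
  rw [inner_sub_right]
  simp at this
  linarith

end NormalCones

/-! ### Invariants of the iterates, the line search and supporting hyperplanes. -/

namespace Data

variable {E F : Type*} [NormedAddCommGroup E] [InnerProductSpace ℝ E]
  [AddCommGroup F] [Module ℝ F]

/-- The standing assumptions on the data, other than boundedness of the sublevel set. -/
structure Regular (d : Data E F) : Prop where
  ne_bot : ∀ x, d.f x ≠ ⊥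
  lsc : LowerSemicontinuous d.f
  convex_epi : Convex ℝ (epi d.f)
  isClosed : IsClosed d.S
  convex : Convex ℝ d.S
  mem_interior : d.ebar ∈ interior (d.S ∩ dom d.f)
  map_ebar : d.A d.ebar = d.b
  lt_fhat : d.f d.ebar < (d.fhat : EReal)

/-- `x` minimises `f` over the feasible set, with value `fstar`. -/
structure IsMinimizer (d : Data E F) (x : E) (fstar : ℝ) : Prop where
  mem : x ∈ d.Feas
  eq : d.f x = fstar
  le : ∀ y ∈ d.Feas, (fstar : EReal) ≤ d.f y

/-- `(g, δ)` defines a supporting hyperplane at `(xp, tp)` of the part of the epigraph over `S`,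
normalised at `(ebar, fhat)`. -/
def Supports (d : Data E F) (g : E) (δ : ℝ) (xp : E) (tp : ℝ) : Prop :=
  (∀ y s, y ∈ d.S → d.f y ≤ ((s : ℝ) : EReal) →
    ⟪g, y - d.ebar⟫_ℝ + δ * (s - d.fhat) ≤ 1) ∧
  ⟪g, xp - d.ebar⟫_ℝ + δ * (tp - d.fhat) = 1

/-- What every iterate satisfies: the primed point is a boundary point on the ray of the unprimed
one, with parameter less than `4 / 3`. -/
structure Inv (d : Data E F) (s : State E) : Prop where
  map_x : d.A s.x = d.b
  t_le : s.t ≤ (d.f d.ebar).toReal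
  mem : s.xp ∈ d.S
  le : d.f s.xp ≤ (s.tp : EReal)
  bdy : s.xp ∈ frontier d.S ∨ (s.xp, s.tp) ∈ frontier (epi d.f)
  ray : ∃ α : ℝ, 0 < α ∧ α < 4 / 3 ∧ s.xp = d.rayX s.x α ∧ s.tp = d.rayT s.t α

variable {d : Data E F}

lemma map_rayX (h : d.Regular) {x : E} (hx : d.A x = d.b) (α : ℝ) : d.A (d.rayX x α) = d.b := by
  simp [rayX, hx, h.map_ebar]

lemma map_P [FiniteDimensional ℝ E] (g : E) : d.A (d.P g) = 0 :=
  LinearMap.mem_ker.1 ((LinearMap.ker d.A).starProjection_apply_mem g)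

lemma map_xtilde [FiniteDimensional ℝ E] {s : State E} (hs : d.A s.x = d.b) (ε : ℝ) (g : E) :
    d.A (d.xtilde ε s g) = d.b := by
  simp [xtilde, hs, map_P]

namespace Regular

lemma ebar_mem_dom (h : d.Regular) : d.ebar ∈ dom d.f := (interior_subset h.mem_interior).2

lemma ebar_mem (h : d.Regular) : d.ebar ∈ d.S := (interior_subset h.mem_interior).1

lemma coe_toReal_ebar (h : d.Regular) : ((d.f d.ebar).toReal : EReal) = d.f d.ebar :=
  coe_toReal_of_mem_dom h.ne_bot h.ebar_mem_dom

lemma toReal_lt_fhat (h : d.Regular) : (d.f d.ebar).toReal < d.fhat := by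
  rw [← EReal.coe_lt_coe_iff, h.coe_toReal_ebar]
  exact h.lt_fhat

lemma ebar_mem_interior (h : d.Regular) : d.ebar ∈ interior d.S :=
  interior_mono Set.inter_subset_left h.mem_interior

lemma ebar_fhat_mem_interior [FiniteDimensional ℝ E] (h : d.Regular) :
    (d.ebar, d.fhat) ∈ interior (epi d.f) :=
  mem_interior_epi h.ne_bot h.convex_epi
    (interior_mono Set.inter_subset_right h.mem_interior) h.lt_fhat

lemma isClosed_sublevel [FiniteDimensional ℝ E] (h : d.Regular) :
    IsClosed {x | x ∈ d.Feas ∧ d.f x ≤ d.f d.ebar} := by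
  have h1 : IsClosed {x | d.A x = d.b} := by
    have : {x | d.A x = d.b} = (fun x => x - d.ebar) ⁻¹' (LinearMap.ker d.A : Set E) := by
      ext x
      simp [h.map_ebar, sub_eq_zero]
    rw [this]
    exact (Submodule.closed_of_finiteDimensional _).preimage (by fun_prop)
  exact (h.isClosed.inter h1).inter (h.lsc.isClosed_preimage _)

lemma exists_isMinimizer [FiniteDimensional ℝ E] (h : d.Regular) (hD : d.Dbar ≠ ⊤) :
    ∃ x fstar, d.IsMinimizer x fstar := by
  have hcomp : IsCompact {x | x ∈ d.Feas ∧ d.f x ≤ d.f d.ebar} :=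
    Metric.isCompact_of_isClosed_isBounded h.isClosed_sublevel
      (Metric.isBounded_iff_ediam_ne_top.2 hD)
  have hne : {x | x ∈ d.Feas ∧ d.f x ≤ d.f d.ebar}.Nonempty :=
    ⟨d.ebar, ⟨h.ebar_mem, h.map_ebar⟩, le_rfl⟩
  obtain ⟨x, hx, hmin⟩ := LowerSemicontinuousOn.exists_isMinOn hne hcomp (h.lsc.lowerSemicontinuousOn _)
  have hreal : ((d.f x).toReal : EReal) = d.f x :=
    coe_toReal_of_mem_dom h.ne_bot (hx.2.trans_lt h.ebar_mem_dom)
  refine ⟨x, (d.f x).toReal, hx.1, hreal.symm, fun y hy => ?_⟩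
  rw [hreal]
  rcases le_total (d.f y) (d.f d.ebar) with hle | hle
  · exact hmin ⟨hy, hle⟩
  · exact hx.2.trans hle

/-- The line search is well defined and ends at a boundary point. -/
lemma alpha_spec [FiniteDimensional ℝ E] (h : d.Regular) {x y : E} {t fstar : ℝ}
    (hm : d.IsMinimizer y fstar) (hx : d.A x = d.b) (ht : t < d.fhat) :
    0 < d.alpha x t ∧ d.rayX x (d.alpha x t) ∈ d.S ∧
      d.f (d.rayX x (d.alpha x t)) ≤ (d.rayT t (d.alpha x t) : EReal) ∧
      (d.rayX x (d.alpha x t) ∈ frontier d.S ∨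
        (d.rayX x (d.alpha x t), d.rayT t (d.alpha x t)) ∈ frontier (epi d.f)) := by
  have e1 : d.alpha1 x = raySup d.S d.ebar (x - d.ebar) := rfl
  -- The epigraph condition is again a ray search, now in the product space from (ebar, fhat).
  have e2 : d.alpha2 x t = raySup (epi d.f) (d.ebar, d.fhat) (x - d.ebar, t - d.fhat) := rfl
  have hi := h.ebar_fhat_mem_interior
  have hpos : 0 < min (d.alpha1 x) (d.alpha2 x t) := by
    rw [e1, e2]
    exact lt_min (raySup_pos h.ebar_mem_interior) (raySup_pos hi)
  have hbound : ∀ α : ℝ, 0 ≤ α → (α : EReal) < min (d.alpha1 x) (d.alpha2 x t) →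
      fstar ≤ d.fhat + α * (t - d.fhat) := by
    intro α hα hlt
    rw [lt_min_iff, e1, e2] at hlt
    have h1 : d.rayX x α ∈ d.S := ray_mem_of_lt_raySup h.convex h.ebar_mem hα hlt.1
    have h2 : d.f (d.rayX x α) ≤ (d.rayT t α : EReal) :=
      ray_mem_of_lt_raySup h.convex_epi (interior_subset hi) hα hlt.2
    exact EReal.coe_le_coe_iff.1 ((hm.le _ ⟨h1, map_rayX h hx α⟩).trans h2)
  have htop : min (d.alpha1 x) (d.alpha2 x t) ≠ ⊤ := by
    intro htop
    -- This parameter takes the ray to height f* - (fhat - t), below the optimal value, although the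
    -- point would be feasible.
    have hlt : ((d.fhat - fstar) / (d.fhat - t) + 1) * (t - d.fhat) =
        -(d.fhat - fstar) + (t - d.fhat) := by
      have : d.fhat - t ≠ 0 := by linarith
      field_simp
      ring
    have hf : fstar ≤ d.fhat := by
      simpa using hbound 0 le_rfl (by simpa using hpos)
    have := hbound ((d.fhat - fstar) / (d.fhat - t) + 1)
      (add_nonneg (div_nonneg (by linarith) (by linarith)) zero_le_one)
      (htop ▸ EReal.coe_lt_top _)
    linarith
  have hcoe : (d.alpha x t : EReal) = min (d.alpha1 x) (d.alpha2 x t) :=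
    EReal.coe_toReal htop (ne_bot_of_gt hpos)
  have hα : 0 < d.alpha x t := by
    rw [← hcoe] at hpos
    exact_mod_cast hpos
  refine ⟨hα, ray_mem_of_le_raySup h.convex h.isClosed h.ebar_mem hα
      (hcoe.trans_le (min_le_left _ _)),
    ray_mem_of_le_raySup (w := (x - d.ebar, t - d.fhat)) h.convex_epi (isClosed_epi h.lsc)
      (interior_subset hi) hα
      (hcoe.trans_le (min_le_right _ _)), ?_⟩
  rcases min_choice (d.alpha1 x) (d.alpha2 x t) with hc | hc
  · exact Or.inl (ray_mem_frontier h.convex h.isClosed h.ebar_mem hα (hcoe.trans hc))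
  · exact Or.inr (ray_mem_frontier h.convex_epi (isClosed_epi h.lsc) (interior_subset hi) hα
      (hcoe.trans (hc.trans e2)))

lemma inv_init (h : d.Regular) : d.Inv d.init where
  map_x := h.map_ebar
  t_le := le_rfl
  mem := h.ebar_mem
  le := h.coe_toReal_ebar.ge
  bdy := by
    right
    rw [(isClosed_epi h.lsc).frontier_eq]
    refine ⟨h.coe_toReal_ebar.ge, fun hint => ?_⟩
    -- An interior point of the epigraph could be lowered slightly, which is impossible on the
    -- graph.
    have hev := eventually_ray_mem (C := epi d.f) (e := (d.init.xp, d.init.tp))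
      (w := (0, -1)) 0 (by simpa using hint)
    obtain ⟨β, hβ, hβ0⟩ := ((hev.filter_mono nhdsWithin_le_nhds).and
      (self_mem_nhdsWithin (s := Set.Ioi (0 : ℝ)))).exists
    have hβ' : d.f d.ebar ≤ (((d.f d.ebar).toReal - β : ℝ) : EReal) := by
      simpa [epi, init, sub_eq_add_neg] using hβ
    rw [← h.coe_toReal_ebar] at hβ'
    have := EReal.coe_le_coe_iff.1 hβ'
    have hβ0 : 0 < β := hβ0
    simp only [EReal.toReal_coe] at this
    linarith
  ray := ⟨1, by norm_num, by norm_num, by simp [rayX, init], by simp [rayT, init]⟩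

/-- After a restart the primed and unprimed points coincide, so the ray parameter becomes 1, and t
has not increased because α ≥ 1 and t < fhat. Without a restart, the failed test is the bound α <
4/3. -/
lemma inv_lineSearch [FiniteDimensional ℝ E] (h : d.Regular) {y z : E} {t fstar : ℝ}
    (hm : d.IsMinimizer y fstar) (hx : d.A z = d.b) (ht : t ≤ (d.f d.ebar).toReal) :
    d.Inv (if 4 / 3 ≤ d.alpha z t then
      ⟨(d.radialProj z t).1, (d.radialProj z t).2, (d.radialProj z t).1, (d.radialProj z t).2⟩
      else ⟨z, t, (d.radialProj z t).1, (d.radialProj z t).2⟩) := by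
  have hlt := h.toReal_lt_fhat
  obtain ⟨hα, hS, hf, hb⟩ := h.alpha_spec hm hx (ht.trans_lt hlt)
  split_ifs with hc
  · refine ⟨map_rayX h hx _, ?_, hS, hf, hb, 1, by norm_num, by norm_num, ?_, ?_⟩
    · simp only [radialProj, rayT]
      nlinarith
    · simp [radialProj, rayX]
    · simp [radialProj, rayT]
  · exact ⟨hx, ht, hS, hf, hb, _, hα, not_le.1 hc, rfl, rfl⟩

lemma inv_step [FiniteDimensional ℝ E] (h : d.Regular) {y : E} {fstar : ℝ}
    (hm : d.IsMinimizer y fstar) {s : State E} (hs : d.Inv s) (ε : ℝ) (g : E) :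
    d.Inv (d.step ε s g) :=
  h.inv_lineSearch hm (map_xtilde hs.map_x ε g) hs.t_le

lemma G_nonempty [FiniteDimensional ℝ E] (h : d.Regular) {s : State E} (hs : d.Inv s) :
    (d.G s.xp s.tp).Nonempty := by
  have h1 : s.xp ∈ frontier d.S → (d.G1 s.xp).Nonempty := fun hx => by
    obtain ⟨v, hv, hv0⟩ := exists_ne_zero_mem_normalCone h.convex ⟨_, h.ebar_mem_interior⟩ hx.2
    exact ⟨_, v, hv, hv0, rfl⟩
  have h2 : (s.xp, s.tp) ∈ frontier (epi d.f) → (d.G2 s.xp s.tp).Nonempty := fun hx => by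
    obtain ⟨v, δ, hv, hv0⟩ :=
      exists_ne_zero_mem_normalConePair h.convex_epi ⟨_, h.ebar_fhat_mem_interior⟩ hx.2
    exact ⟨_, v, δ, hv, hv0, rfl⟩
  by_cases hb1 : s.xp ∈ frontier d.S <;> by_cases hb2 : (s.xp, s.tp) ∈ frontier (epi d.f)
  · obtain ⟨g, hg⟩ := h1 hb1
    exact ⟨g, Or.inr (Or.inr ⟨⟨hb1, hb2⟩, subset_convexHull ℝ _ (Or.inl hg)⟩)⟩
  · obtain ⟨g, hg⟩ := h1 hb1
    exact ⟨g, Or.inl ⟨⟨hb1, hb2⟩, hg⟩⟩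
  · obtain ⟨g, hg⟩ := h2 hb2
    exact ⟨g, Or.inr (Or.inl ⟨⟨hb2, hb1⟩, hg⟩)⟩
  · exact absurd hs.bdy (by tauto)

/-- The invariant guarantees an available direction and survives every step, so the recursion runs
on the subtype it defines. -/
lemma exists_isRun [FiniteDimensional ℝ E] (h : d.Regular) {y : E} {fstar : ℝ}
    (hm : d.IsMinimizer y fstar) (ε : ℝ) : ∃ s, d.IsRun ε s := by
  choose g hg using fun s : {s : State E // d.Inv s} => h.G_nonempty s.2
  let next : {s : State E // d.Inv s} → {s : State E // d.Inv s} := fun s =>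
    ⟨d.step ε s.1 (g s), h.inv_step hm s.2 ε (g s)⟩
  let run : ℕ → {s : State E // d.Inv s} := fun k => next^[k] ⟨d.init, h.inv_init⟩
  refine ⟨fun k => (run k).1, rfl, fun k => ⟨g (run k), hg (run k), ?_⟩⟩
  have : run (k + 1) = next (run k) := Function.iterate_succ_apply' _ _ _
  exact congrArg Subtype.val this

lemma inv_of_isRun [FiniteDimensional ℝ E] (h : d.Regular) {y : E} {fstar ε : ℝ}
    (hm : d.IsMinimizer y fstar) {s : ℕ → State E} (hs : d.IsRun ε s) (k : ℕ) : d.Inv (s k) := by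
  induction k with
  | zero => exact hs.1 ▸ h.inv_init
  | succ k ih =>
    obtain ⟨g, -, hg⟩ := hs.2 k
    exact hg ▸ h.inv_step hm ih ε g

/-- Dividing the normal cone inequality by a positive number normalises it at (ebar, fhat);
membership in S does not involve the height, hence δ = 0. -/
lemma exists_supports_of_mem_G1 (h : d.Regular) {g xp : E} {tp : ℝ} (hg : g ∈ d.G1 xp) :
    ∃ δ, d.Supports g δ xp tp := by
  obtain ⟨v, hv, hv0, rfl⟩ := hg
  have hN := inner_lt_zero_of_mem_normalCone h.ebar_mem_interior hv hv0
  have hN0 := hN.ne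
  have hx : ∀ y, ⟪(-1 / ⟪v, d.ebar - xp⟫_ℝ) • v, y - d.ebar⟫_ℝ =
      1 + ⟪v, y - xp⟫_ℝ / -⟪v, d.ebar - xp⟫_ℝ := fun y => by
    rw [real_inner_smul_left, show y - d.ebar = (y - xp) - (d.ebar - xp) by abel,
      inner_sub_right v (y - xp)]
    field_simp
    ring
  refine ⟨0, fun y s hy _ => ?_, ?_⟩
  · rw [hx]
    have := div_nonpos_of_nonpos_of_nonneg (hv y hy) (neg_nonneg.2 hN.le)
    linarith
  · rw [hx]
    simp

lemma exists_supports_of_mem_G2 [FiniteDimensional ℝ E] (h : d.Regular) {g xp : E} {tp : ℝ}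
    (hg : g ∈ d.G2 xp tp) : ∃ δ, d.Supports g δ xp tp := by
  obtain ⟨v, δ, hv, hv0, rfl⟩ := hg
  have hN := inner_add_lt_zero_of_mem_normalConePair h.ebar_fhat_mem_interior hv hv0
  set N := ⟪v, d.ebar - xp⟫_ℝ + (d.fhat - tp) * δ with hNdef
  have hN0 := hN.ne
  have hx : ∀ y s, ⟪(-1 / N) • v, y - d.ebar⟫_ℝ + (-1 / N * δ) * (s - d.fhat) =
      1 + (⟪v, y - xp⟫_ℝ + δ * (s - tp)) / -N := fun y s => by
    rw [real_inner_smul_left, show y - d.ebar = (y - xp) - (d.ebar - xp) by abel,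
      inner_sub_right v (y - xp)]
    field_simp
    rw [hNdef]
    ring
  refine ⟨-1 / N * δ, fun y s hy hs => ?_, ?_⟩
  · rw [hx]
    have := div_nonpos_of_nonpos_of_nonneg (hv (y, s) hs) (neg_nonneg.2 hN.le)
    linarith
  · rw [hx]
    simp

/-- Both conditions in `Supports` are affine in (g, δ), so they pass to the convex hull. -/
lemma exists_supports [FiniteDimensional ℝ E] (h : d.Regular) {g xp : E} {tp : ℝ}
    (hg : g ∈ d.G xp tp) : ∃ δ, d.Supports g δ xp tp := by
  rcases hg with ⟨-, hg⟩ | ⟨-, hg⟩ | ⟨-, hg⟩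
  · exact h.exists_supports_of_mem_G1 hg
  · exact h.exists_supports_of_mem_G2 hg
  · have hsub : d.G1 xp ∪ d.G2 xp tp ⊆ {g | ∃ δ, d.Supports g δ xp tp} := by
      rintro g (hg | hg)
      · exact h.exists_supports_of_mem_G1 hg
      · exact h.exists_supports_of_mem_G2 hg
    refine convexHull_min hsub ?_ hg
    rintro g₁ ⟨δ₁, h₁, h₁'⟩ g₂ ⟨δ₂, h₂, h₂'⟩ a b ha hb hab
    refine ⟨a * δ₁ + b * δ₂, fun y s hy hs => ?_, ?_⟩
    · rw [inner_add_left, real_inner_smul_left, real_inner_smul_left]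
      have e1 := mul_le_mul_of_nonneg_left (h₁ y s hy hs) ha
      have e2 := mul_le_mul_of_nonneg_left (h₂ y s hy hs) hb
      linarith
    · rw [inner_add_left, real_inner_smul_left, real_inner_smul_left]
      linear_combination a * h₁' + b * h₂' + hab

end Regular

end Data

/-! ### Decrease of the potential and the iteration bound. -/

namespace Data

variable {E F : Type*} [NormedAddCommGroup E] [InnerProductSpace ℝ E]
  [AddCommGroup F] [Module ℝ F]

/-- The height `t` below `fhat`, relative to that of the optimal value. -/
def relHeight (d : Data E F) (fstar t : ℝ) : ℝ := (d.fhat - t) / (d.fhat - fstar)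

/-- `ρ` is one of the radii whose supremum is `rhat`. -/
def IsInnerRadius (d : Data E F) (ρ : ℝ) : Prop :=
  ∀ x, ‖x - d.ebar‖ ≤ ρ ∧ d.A x = d.b → x ∈ d.S ∧ d.f x ≤ (d.fhat : EReal)

/-- The potential that drops by at least one in every step from an iterate that is not yet
`ε`-optimal. -/
def potential (d : Data E F) (y : E) (fstar ε ρ : ℝ) (s : State E) : ℝ :=
  phaseCost ε (d.relHeight fstar s.t) *
      (‖s.x - d.rayX y (d.relHeight fstar s.t)‖ ^ 2 / ρ ^ 2) +
    (d.Dbar.toReal / ρ) ^ 2 * futureCost ε (d.relHeight fstar s.t)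

variable {d : Data E F} {y : E} {fstar ε ρ : ℝ}

lemma norm_sub_le_Dbar (hD : d.Dbar ≠ ⊤) {x z : E} (hx : x ∈ d.Feas ∧ d.f x ≤ d.f d.ebar)
    (hz : z ∈ d.Feas ∧ d.f z ≤ d.f d.ebar) : ‖x - z‖ ≤ d.Dbar.toReal := by
  have := Metric.edist_le_ediam_of_mem (s := {x | x ∈ d.Feas ∧ d.f x ≤ d.f d.ebar}) hx hz
  rw [← dist_eq_norm, dist_edist]
  exact ENNReal.toReal_mono hD this

lemma inner_P_eq [FiniteDimensional ℝ E] {w : E} (hw : d.A w = 0) (g : E) :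
    ⟪d.P g, w⟫_ℝ = ⟪g, w⟫_ℝ := by
  rw [P, Submodule.inner_starProjection_left_eq_right,
    Submodule.starProjection_eq_self_iff.2 (LinearMap.mem_ker.2 hw)]

namespace Regular

lemma fstar_le (h : d.Regular) (hm : d.IsMinimizer y fstar) : fstar ≤ (d.f d.ebar).toReal := by
  rw [← EReal.coe_le_coe_iff, h.coe_toReal_ebar]
  exact hm.le _ ⟨h.ebar_mem, h.map_ebar⟩

lemma fstar_lt_fhat (h : d.Regular) (hm : d.IsMinimizer y fstar) : fstar < d.fhat :=
  (h.fstar_le hm).trans_lt h.toReal_lt_fhat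

lemma relHeight_pos (h : d.Regular) (hm : d.IsMinimizer y fstar) {t : ℝ}
    (ht : t ≤ (d.f d.ebar).toReal) : 0 < d.relHeight fstar t :=
  div_pos (sub_pos.2 (ht.trans_lt h.toReal_lt_fhat)) (sub_pos.2 (h.fstar_lt_fhat hm))

lemma relHeight_le_one (h : d.Regular) (hm : d.IsMinimizer y fstar) {t : ℝ} (ht : fstar ≤ t) :
    d.relHeight fstar t ≤ 1 := by
  have := h.fstar_lt_fhat hm
  rw [relHeight, div_le_one (by linarith)]
  linarith

lemma relHeight_rayT (d : Data E F) (fstar t α : ℝ) :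
    d.relHeight fstar (d.rayT t α) = α * d.relHeight fstar t := by
  simp only [relHeight, rayT]
  ring

lemma rayX_mem_sublevel (h : d.Regular) (hm : d.IsMinimizer y fstar) {u : ℝ} (hu : 0 ≤ u)
    (hu1 : u ≤ 1) : d.rayX y u ∈ d.Feas ∧ d.f (d.rayX y u) ≤ d.f d.ebar := by
  have e : d.rayX y u = (1 - u) • d.ebar + u • y := by
    rw [rayX, smul_sub, sub_smul, one_smul]
    abel
  refine ⟨⟨?_, map_rayX h hm.mem.2 u⟩, ?_⟩
  · rw [e]
    exact h.convex h.ebar_mem hm.mem.1 (sub_nonneg.2 hu1) hu (by ring)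
  · have hy : d.f y ≤ ((d.f d.ebar).toReal : EReal) := by
      rw [hm.eq]
      exact_mod_cast h.fstar_le hm
    have := h.convex_epi (x := (d.ebar, (d.f d.ebar).toReal)) (y := (y, (d.f d.ebar).toReal))
      h.coe_toReal_ebar.ge hy (sub_nonneg.2 hu1) hu (by ring)
    have h2 : d.f ((1 - u) • d.ebar + u • y) ≤
        (((1 - u) * (d.f d.ebar).toReal + u * (d.f d.ebar).toReal : ℝ) : EReal) := this
    rw [e, ← h.coe_toReal_ebar]
    convert h2 using 2
    ring

/-- The projected direction has norm at most `1 / ρ`. -/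
lemma mul_norm_P_le [FiniteDimensional ℝ E] (h : d.Regular) (hρ : 0 < ρ)
    (hr : d.IsInnerRadius ρ) {g xp : E} {δ tp : ℝ} (hg : d.Supports g δ xp tp) :
    ρ * ‖d.P g‖ ≤ 1 := by
  rcases eq_or_ne (d.P g) 0 with h0 | h0
  · simp [h0]
  have hn : 0 < ‖d.P g‖ := norm_pos_iff.2 h0
  -- At height fhat the δ-term vanishes, so the size of δ plays no role.
  obtain ⟨hS, hf⟩ := hr (d.ebar + (ρ / ‖d.P g‖) • d.P g) ⟨by
    rw [add_sub_cancel_left, norm_smul, Real.norm_eq_abs, abs_of_pos (by positivity),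
      div_mul_cancel₀ _ hn.ne'], by simp [h.map_ebar, map_P]⟩
  have := hg.1 _ _ hS hf
  rw [add_sub_cancel_left, real_inner_smul_right, ← inner_P_eq (map_P g),
    real_inner_self_eq_norm_sq, sub_self, mul_zero, add_zero] at this
  calc ρ * ‖d.P g‖ = ρ / ‖d.P g‖ * ‖d.P g‖ ^ 2 := by field_simp
    _ ≤ 1 := this

/-- The subgradient inequality for the radial gauge at fixed height. -/
lemma gap_le_inner (h : d.Regular) (hm : d.IsMinimizer y fstar) {g x : E} {δ t α : ℝ}
    (hα : 0 < α) (ht : t ≤ (d.f d.ebar).toReal)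
    (hg : d.Supports g δ (d.rayX x α) (d.rayT t α)) :
    1 / α - d.relHeight fstar t ≤ ⟪g, x - d.rayX y (d.relHeight fstar t)⟫_ℝ := by
  have hu := (h.relHeight_pos hm ht).le
  have hlt := sub_pos.2 (h.fstar_lt_fhat hm)
  have hmul : d.relHeight fstar t * (fstar - d.fhat) = t - d.fhat := by
    rw [relHeight]
    field_simp
    ring
  set u := d.relHeight fstar t
  have h1 := mul_le_mul_of_nonneg_left (hg.1 y fstar hm.mem.1 hm.eq.le) hu
  have h2 := hg.2
  simp only [rayX, rayT, add_sub_cancel_left, real_inner_smul_right] at h2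
  have h3 : ⟪g, x - d.ebar⟫_ℝ + δ * (t - d.fhat) = 1 / α := by
    rw [eq_div_iff hα.ne']
    linarith
  have h4 : ⟪g, x - d.rayX y u⟫_ℝ = ⟪g, x - d.ebar⟫_ℝ - u * ⟪g, y - d.ebar⟫_ℝ := by
    rw [rayX, ← sub_sub, inner_sub_right, real_inner_smul_right]
  rw [h4]
  -- The scaled optimum has the same height t as the iterate, so the δ-terms cancel on subtraction.
  have h5 : u * (⟪g, y - d.ebar⟫_ℝ + δ * (fstar - d.fhat)) =
      u * ⟪g, y - d.ebar⟫_ℝ + δ * (t - d.fhat) := by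
    rw [← hmul]
    ring
  linarith

lemma potential_nonneg (h : d.Regular) (hm : d.IsMinimizer y fstar) (hε : 0 < ε) {s : State E}
    (hs : d.Inv s) : 0 ≤ d.potential y fstar ε ρ s := by
  have h1 := futureCost_nonneg hε (h.relHeight_pos hm hs.t_le)
  have h2 := phaseCost_nonneg (u := d.relHeight fstar s.t) hε
  unfold potential
  positivity

lemma potential_step_le [FiniteDimensional ℝ E] (h : d.Regular) (hD : d.Dbar ≠ ⊤)
    (hm : d.IsMinimizer y fstar) (hε : 0 < ε) (hρ : 0 < ρ) (hr : d.IsInnerRadius ρ)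
    {s : State E} (hs : d.Inv s) {g : E} (hg : g ∈ d.G s.xp s.tp)
    (hopt : ε < ((d.f s.xp).toReal - fstar) / (d.fhat - fstar)) :
    d.potential y fstar ε ρ (d.step ε s g) + 1 ≤ d.potential y fstar ε ρ s := by
  obtain ⟨δ, hδ⟩ := h.exists_supports hg
  obtain ⟨α, hα, hα4, hxp, htp⟩ := hs.ray
  have hlt := sub_pos.2 (h.fstar_lt_fhat hm)
  have hu := h.relHeight_pos hm hs.t_le
  have hft : (d.f s.xp).toReal ≤ s.tp := by
    rw [← EReal.coe_le_coe_iff,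
      coe_toReal_of_mem_dom h.ne_bot (hs.le.trans_lt (EReal.coe_lt_top _))]
    exact hs.le
  -- The primed height tp has relative height αu and lies above f at the primed point.
  have hgapα : ε < 1 - α * d.relHeight fstar s.t := by
    have e : 1 - α * d.relHeight fstar s.t = (s.tp - fstar) / (d.fhat - fstar) := by
      rw [htp, relHeight, rayT]
      field_simp
      ring
    rw [e]
    exact hopt.trans_le (by gcongr)
  have hgapα' : ε * (1 / α) < 1 / α - d.relHeight fstar s.t := by
    have := mul_lt_mul_of_pos_right hgapα (one_div_pos.2 hα)
    rwa [sub_mul, one_mul, mul_right_comm, mul_one_div_cancel hα.ne', one_mul] at this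
  have h34 : 3 / 4 < 1 / α := by
    rw [lt_div_iff₀ hα]
    linarith
  have hin : 1 / α - d.relHeight fstar s.t ≤
      ⟪d.P g, s.x - d.rayX y (d.relHeight fstar s.t)⟫_ℝ := by
    rw [inner_P_eq (by rw [map_sub, hs.map_x, map_rayX h hm.mem.2, sub_self])]
    exact h.gap_le_inner hm hα hs.t_le (by rw [← hxp, ← htp]; exact hδ)
  set u := d.relHeight fstar s.t with hudef
  have hgap1 : 3 * ε / 4 ≤ 1 / α - u := by nlinarith
  have hgap2 : 3 / 4 - u ≤ 1 / α - u := by linarith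
  have hstep := norm_step_sq_le hε hgap1 hρ (h.mul_norm_P_le hρ hr hδ) hin
  have hcost := one_le_phaseCost_mul hε hgap1 hgap2
  have hc0 := phaseCost_nonneg (u := u) hε
  have hdrop : phaseCost ε u * (‖d.xtilde ε s g - d.rayX y u‖ ^ 2 / ρ ^ 2) + 1 ≤
      phaseCost ε u * (‖s.x - d.rayX y u‖ ^ 2 / ρ ^ 2) := by
    have := mul_le_mul_of_nonneg_left hstep hc0
    rw [mul_sub] at this
    rw [xtilde]
    linarith
  have hz := map_xtilde hs.map_x ε g
  have hinv := h.inv_step hm hs ε g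
  by_cases hc : 4 / 3 ≤ d.alpha (d.xtilde ε s g) s.t
  · have hst : d.step ε s g = ⟨(d.radialProj (d.xtilde ε s g) s.t).1,
        (d.radialProj (d.xtilde ε s g) s.t).2, (d.radialProj (d.xtilde ε s g) s.t).1,
        (d.radialProj (d.xtilde ε s g) s.t).2⟩ := if_pos hc
    set s' := d.step ε s g
    have ht' : s'.t = d.rayT s.t (d.alpha (d.xtilde ε s g) s.t) := by rw [hst]; rfl
    have hx' : s'.x = s'.xp := by rw [hst]
    have htt : s'.t = s'.tp := by rw [hst]
    have hfeas : s'.x ∈ d.Feas := ⟨hx' ▸ hinv.mem, hinv.map_x⟩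
    have hle : d.f s'.x ≤ (s'.t : EReal) := by rw [hx', htt]; exact hinv.le
    have hu1 : d.relHeight fstar s'.t ≤ 1 := h.relHeight_le_one hm
      (EReal.coe_le_coe_iff.1 ((hm.le _ hfeas).trans hle))
    have hu0 := h.relHeight_pos hm hinv.t_le
    have hup : 4 / 3 * u ≤ d.relHeight fstar s'.t := by
      rw [ht', relHeight_rayT]
      exact mul_le_mul_of_nonneg_right hc hu.le
    have hsub : d.f s'.x ≤ d.f d.ebar := by
      rw [← h.coe_toReal_ebar]
      exact hle.trans (EReal.coe_le_coe_iff.2 hinv.t_le)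
    have hdist := norm_sub_le_Dbar hD ⟨hfeas, hsub⟩ (h.rayX_mem_sublevel hm hu0.le hu1)
    have hfut := phaseCost_add_futureCost_le hε hu hup hu1
    have hc1 := phaseCost_nonneg (u := d.relHeight fstar s'.t) hε
    have hq : ‖s'.x - d.rayX y (d.relHeight fstar s'.t)‖ ^ 2 / ρ ^ 2 ≤
        (d.Dbar.toReal / ρ) ^ 2 := by
      rw [div_pow]
      gcongr
    -- At a restart the old distance term is discarded, and the new one is charged to `futureCost`.
    have h0 : 0 ≤ phaseCost ε u * (‖d.xtilde ε s g - d.rayX y u‖ ^ 2 / ρ ^ 2) := by positivity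
    have e1 := mul_le_mul_of_nonneg_left hq hc1
    have e2 := mul_le_mul_of_nonneg_left hfut (sq_nonneg (d.Dbar.toReal / ρ))
    unfold potential
    rw [← hudef]
    linarith
  -- Within a phase the height and the target are unchanged, so `hdrop` suffices.
  · have hst : d.step ε s g = ⟨d.xtilde ε s g, s.t, (d.radialProj (d.xtilde ε s g) s.t).1,
        (d.radialProj (d.xtilde ε s g) s.t).2⟩ := if_neg hc
    rw [hst]
    unfold potential
    rw [← hudef]
    linarith

/-- The optimal gap, measured from `fhat`, is at most `1 + Dbar / ρ` times the initial one. -/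
lemma one_div_relHeight_le (h : d.Regular) (hD : d.Dbar ≠ ⊤)
    (hm : d.IsMinimizer y fstar) (hρ : 0 < ρ) (hr : d.IsInnerRadius ρ) :
    1 / d.relHeight fstar (d.f d.ebar).toReal ≤ 1 + d.Dbar.toReal / ρ := by
  have hD0 : 0 ≤ d.Dbar.toReal := ENNReal.toReal_nonneg
  have hu := h.relHeight_pos hm le_rfl
  have hlt := h.fstar_lt_fhat hm
  have h0 := h.toReal_lt_fhat
  have hy : d.f y ≤ d.f d.ebar := by
    rw [hm.eq]
    exact hm.le _ ⟨h.ebar_mem, h.map_ebar⟩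
  have hdist := norm_sub_le_Dbar hD ⟨hm.mem, hy⟩ ⟨⟨h.ebar_mem, h.map_ebar⟩, le_rfl⟩
  set n := ‖y - d.ebar‖ with hn
  rcases eq_or_ne y d.ebar with rfl | hne
  · have : (d.f d.ebar).toReal = fstar := by rw [hm.eq, EReal.toReal_coe]
    rw [this, relHeight, div_self (by linarith)]
    have : 0 ≤ d.Dbar.toReal / ρ := by positivity
    linarith
  have hn0 : 0 < n := norm_pos_iff.2 (sub_ne_zero.2 hne)
  -- The point at distance ρ from ebar opposite to y has value at most fhat. Convexity along the
  -- segment from it to y, which contains ebar, bounds f(ebar).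
  obtain ⟨hS, hf⟩ := hr (d.ebar - (ρ / n) • (y - d.ebar)) ⟨by
    rw [sub_sub_cancel_left, norm_neg, norm_smul, Real.norm_eq_abs, abs_of_pos (by positivity),
      ← hn, div_mul_cancel₀ _ hn0.ne'], by simp [h.map_ebar, hm.mem.2]⟩
  have hcomb := h.convex_epi (x := (y, fstar)) (y := (d.ebar - (ρ / n) • (y - d.ebar), d.fhat))
    hm.eq.le hf (a := ρ / (ρ + n)) (b := n / (ρ + n)) (by positivity) (by positivity)
    (by field_simp)
  have hpt : (ρ / (ρ + n)) • y + (n / (ρ + n)) • (d.ebar - (ρ / n) • (y - d.ebar)) = d.ebar := by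
    have e1 : n / (ρ + n) * (ρ / n) = ρ / (ρ + n) := by field_simp
    have e2 : n / (ρ + n) = 1 - ρ / (ρ + n) := by field_simp; ring
    rw [smul_sub, smul_smul, e1, e2, smul_sub, sub_smul, one_smul]
    abel
  have hval : d.f ((ρ / (ρ + n)) • y + (n / (ρ + n)) • (d.ebar - (ρ / n) • (y - d.ebar))) ≤
      ((ρ / (ρ + n) * fstar + n / (ρ + n) * d.fhat : ℝ) : EReal) := hcomb
  rw [hpt, ← h.coe_toReal_ebar, EReal.coe_le_coe_iff] at hval
  have hkey : ρ * (d.fhat - fstar) ≤ (ρ + n) * (d.fhat - (d.f d.ebar).toReal) := by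
    have := mul_le_mul_of_nonneg_left hval (by positivity : 0 ≤ ρ + n)
    have e : (ρ + n) * (ρ / (ρ + n) * fstar + n / (ρ + n) * d.fhat) = ρ * fstar + n * d.fhat := by
      field_simp
    rw [e] at this
    linarith
  rw [relHeight, one_div_div, div_le_iff₀ (by linarith)]
  have e : 1 + d.Dbar.toReal / ρ = (ρ + d.Dbar.toReal) / ρ := by field_simp
  rw [e, div_mul_eq_mul_div, le_div_iff₀ hρ]
  nlinarith

lemma potential_init_le (h : d.Regular) (hD : d.Dbar ≠ ⊤) (hm : d.IsMinimizer y fstar)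
    (hε : 0 < ε) (hρ : 0 < ρ) (hr : d.IsInnerRadius ρ) :
    d.potential y fstar ε ρ d.init ≤ 8 * (d.Dbar.toReal / ρ) ^ 2 *
      (1 / ε ^ 2 + 1 / ε * Real.logb (4 / 3) (1 + d.Dbar.toReal / ρ)) := by
  have hu := h.relHeight_pos hm le_rfl
  have hu1 := h.relHeight_le_one hm (h.fstar_le hm)
  have hlog := Real.logb_le_logb_of_le (b := 4 / 3) (by norm_num) (by positivity)
    (h.one_div_relHeight_le hD hm hρ hr)
  have htot := phaseCost_add_futureCost_le_total hε hu hu1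
  have hdist := norm_sub_le_Dbar hD ⟨⟨h.ebar_mem, h.map_ebar⟩, le_rfl⟩
    (h.rayX_mem_sublevel hm hu.le hu1)
  set u := d.relHeight fstar (d.f d.ebar).toReal
  have hc := phaseCost_nonneg (u := u) hε
  calc d.potential y fstar ε ρ d.init
      = phaseCost ε u * (‖d.ebar - d.rayX y u‖ ^ 2 / ρ ^ 2) +
        (d.Dbar.toReal / ρ) ^ 2 * futureCost ε u := rfl
    _ ≤ phaseCost ε u * (d.Dbar.toReal ^ 2 / ρ ^ 2) +
        (d.Dbar.toReal / ρ) ^ 2 * futureCost ε u := by gcongr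
    _ = (d.Dbar.toReal / ρ) ^ 2 * (phaseCost ε u + futureCost ε u) := by ring
    _ ≤ (d.Dbar.toReal / ρ) ^ 2 * (8 * (1 / ε ^ 2 + 1 / ε * Real.logb (4 / 3) (1 / u))) := by
        gcongr
    _ ≤ (d.Dbar.toReal / ρ) ^ 2 *
        (8 * (1 / ε ^ 2 + 1 / ε * Real.logb (4 / 3) (1 + d.Dbar.toReal / ρ))) := by gcongr
    _ = _ := by ring

/-- If none of the first `ℓ + 1` iterates is `ε`-optimal, then `ℓ + 1` is bounded in terms of any
inner radius. -/
lemma succ_le_of_not_optimal [FiniteDimensional ℝ E] (h : d.Regular) (hD : d.Dbar ≠ ⊤)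
    (hm : d.IsMinimizer y fstar) (hε : 0 < ε) (hρ : 0 < ρ) (hr : d.IsInnerRadius ρ)
    {s : ℕ → State E} (hs : d.IsRun ε s) {ℓ : ℕ}
    (hopt : ∀ k ≤ ℓ, ε < ((d.f (s k).xp).toReal - fstar) / (d.fhat - fstar)) :
    (ℓ + 1 : ℝ) ≤ 8 * (d.Dbar.toReal / ρ) ^ 2 *
      (1 / ε ^ 2 + 1 / ε * Real.logb (4 / 3) (1 + d.Dbar.toReal / ρ)) := by
  have hind : ∀ k ≤ ℓ + 1, d.potential y fstar ε ρ (s k) + k ≤ d.potential y fstar ε ρ d.init := by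
    intro k
    induction k with
    | zero => simp [hs.1]
    | succ k ih =>
      intro hk
      obtain ⟨g, hg, hstep⟩ := hs.2 k
      have := h.potential_step_le hD hm hε hρ hr (h.inv_of_isRun hm hs k) hg (hopt k (by omega))
      rw [hstep]
      push_cast
      linarith [ih (by omega)]
  have h1 := hind (ℓ + 1) le_rfl
  have h2 := h.potential_nonneg (ρ := ρ) hm hε (h.inv_of_isRun hm hs (ℓ + 1))
  have h3 := h.potential_init_le hD hm hε hρ hr
  push_cast at h1
  linarith

lemma rhat_ne_zero [FiniteDimensional ℝ E] (h : d.Regular) : d.rhat ≠ 0 := by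
  have h1 : ∀ᶠ x in nhds d.ebar, x ∈ d.S := mem_interior_iff_mem_nhds.1 h.ebar_mem_interior
  have hc : ContinuousAt (fun x : E => (x, d.fhat)) d.ebar := by fun_prop
  have h2 : ∀ᶠ x in nhds d.ebar, (x, d.fhat) ∈ epi d.f :=
    hc.eventually (mem_interior_iff_mem_nhds.1 h.ebar_fhat_mem_interior)
  obtain ⟨ρ, hρ, hball⟩ := Metric.nhds_basis_closedBall.eventually_iff.1 (h1.and h2)
  have hmem : ENNReal.ofReal ρ ≤ d.rhat := le_sSup ⟨ρ, hρ.le, rfl, fun x hx => by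
    have := hball (x := x) (by rw [Metric.mem_closedBall, dist_eq_norm]; exact hx.1)
    exact ⟨this.1, this.2⟩⟩
  exact ((ENNReal.ofReal_pos.2 hρ).trans_le hmem).ne'

/-- As D/q < `rhat`, the supremum supplies a radius above D/q. The extended division treats `rhat` =
∞ in the same way. -/
lemma exists_isInnerRadius [FiniteDimensional ℝ E] (h : d.Regular) (hD : d.Dbar ≠ ⊤) {q : ℝ}
    (hq : (d.Dbar / d.rhat).toReal < q) :
    ∃ ρ, 0 < ρ ∧ d.IsInnerRadius ρ ∧ d.Dbar.toReal / ρ ≤ q := by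
  have hq0 : 0 < q := ENNReal.toReal_nonneg.trans_lt hq
  have hfin : d.Dbar / d.rhat ≠ ⊤ := ENNReal.div_ne_top hD h.rhat_ne_zero
  have h1 : d.Dbar / d.rhat < ENNReal.ofReal q := by
    rwa [← ENNReal.ofReal_toReal hfin, ENNReal.ofReal_lt_ofReal_iff hq0]
  have hq1 : ENNReal.ofReal q ≠ 0 := (ENNReal.ofReal_pos.2 hq0).ne'
  rw [ENNReal.div_lt_iff (Or.inl h.rhat_ne_zero) (Or.inr hD), mul_comm,
    ← ENNReal.div_lt_iff (Or.inl hq1) (Or.inl ENNReal.ofReal_ne_top)] at h1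
  obtain ⟨_, ⟨ρ, -, rfl, hr⟩, hlt⟩ := lt_sSup_iff.1 h1
  have hρ : 0 < ρ := ENNReal.ofReal_pos.1 (zero_le.trans_lt hlt)
  refine ⟨ρ, hρ, hr, ?_⟩
  rw [ENNReal.div_lt_iff (Or.inl hq1) (Or.inl ENNReal.ofReal_ne_top),
    ← ENNReal.ofReal_mul hρ.le] at hlt
  have := ENNReal.toReal_mono ENNReal.ofReal_ne_top hlt.le
  rw [ENNReal.toReal_ofReal (by positivity)] at this
  rw [div_le_iff₀ hρ]
  linarith

lemma exists_optimal [FiniteDimensional ℝ E] (h : d.Regular) (hD : d.Dbar ≠ ⊤)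
    (hm : d.IsMinimizer y fstar) (hε : 0 < ε) {s : ℕ → State E} (hs : d.IsRun ε s) {ℓ : ℕ}
    (hℓ : 8 * (d.Dbar / d.rhat).toReal ^ 2 *
      (1 / ε ^ 2 + 1 / ε * Real.logb (4 / 3) (1 + (d.Dbar / d.rhat).toReal)) ≤ (ℓ : ℝ)) :
    ∃ k ≤ ℓ, ((d.f (s k).xp).toReal - fstar) / (d.fhat - fstar) ≤ ε := by
  by_contra! hopt
  have hq0 : 0 ≤ (d.Dbar / d.rhat).toReal := ENNReal.toReal_nonneg
  have hcont : ContinuousAt (fun q : ℝ => 8 * q ^ 2 *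
      (1 / ε ^ 2 + 1 / ε * Real.logb (4 / 3) (1 + q))) (d.Dbar / d.rhat).toReal := by
    have : ContinuousAt (fun q : ℝ => Real.logb (4 / 3) (1 + q)) (d.Dbar / d.rhat).toReal :=
      ContinuousAt.logb (by fun_prop) (by positivity)
    fun_prop
  -- The supremum `rhat` need not be used as a radius: ℓ + 1 failed steps leave a slack of one over
  -- the assumed bound, which by continuity absorbs the passage to a slightly larger q.
  have hev := hcont.eventually_lt_const (u := (ℓ + 1 : ℝ)) (by linarith)
  obtain ⟨q, hq, hqgt⟩ := ((hev.filter_mono nhdsWithin_le_nhds).and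
    (self_mem_nhdsWithin (s := Set.Ioi (d.Dbar / d.rhat).toReal))).exists
  obtain ⟨ρ, hρ, hr, hle⟩ := h.exists_isInnerRadius hD hqgt
  have hbound := h.succ_le_of_not_optimal hD hm hε hρ hr hs hopt
  have h0 : 0 ≤ d.Dbar.toReal / ρ := div_nonneg ENNReal.toReal_nonneg hρ.le
  have hl : 0 ≤ Real.logb (4 / 3) (1 + d.Dbar.toReal / ρ) :=
    Real.logb_nonneg (by norm_num) (by linarith)
  have hmono : Real.logb (4 / 3) (1 + d.Dbar.toReal / ρ) ≤ Real.logb (4 / 3) (1 + q) :=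
    Real.logb_le_logb_of_le (by norm_num) (by positivity) (by linarith)
  have : 8 * (d.Dbar.toReal / ρ) ^ 2 *
      (1 / ε ^ 2 + 1 / ε * Real.logb (4 / 3) (1 + d.Dbar.toReal / ρ)) ≤
      8 * q ^ 2 * (1 / ε ^ 2 + 1 / ε * Real.logb (4 / 3) (1 + q)) := by gcongr
  linarith

end Regular

end Data

end SubgradA

end

theorem theorem1p1 {E F : Type*} [NormedAddCommGroup E] [InnerProductSpace ℝ E]
    [FiniteDimensional ℝ E] [AddCommGroup F] [Module ℝ F] (d : SubgradA.Data E F)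
    (hf_bot : ∀ x, d.f x ≠ ⊥) (hf_lsc : LowerSemicontinuous d.f)
    (hf_convex : Convex ℝ (SubgradA.epi d.f))
    (hS_closed : IsClosed d.S) (hS_convex : Convex ℝ d.S)
    (he_int : d.ebar ∈ interior (d.S ∩ SubgradA.dom d.f)) (he_eq : d.A d.ebar = d.b)
    (hfhat : d.f d.ebar < (d.fhat : EReal)) (hD : d.Dbar ≠ ⊤)
    (ε : ℝ) (hε0 : 0 < ε) (hε1 : ε < 1) :
    (∃ s : ℕ → SubgradA.State E, d.IsRun ε s) ∧
    ∃ fstar : ℝ, IsLeast (d.f '' d.Feas) (fstar : EReal) ∧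
      ∀ s : ℕ → SubgradA.State E, d.IsRun ε s →
        (∀ k, (s k).xp ∈ d.Feas ∧ d.f (s k).xp < ⊤) ∧
        ∀ ℓ : ℕ,
          8 * (d.Dbar / d.rhat).toReal ^ 2 *
            (1 / ε ^ 2 + 1 / ε * Real.logb (4 / 3) (1 + (d.Dbar / d.rhat).toReal)) ≤ (ℓ : ℝ) →
          ∃ k ≤ ℓ, ((d.f (s k).xp).toReal - fstar) / (d.fhat - fstar) ≤ ε := by
  have h : d.Regular :=
    ⟨hf_bot, hf_lsc, hf_convex, hS_closed, hS_convex, he_int, he_eq, hfhat⟩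
  obtain ⟨y, fstar, hm⟩ := h.exists_isMinimizer hD
  refine ⟨h.exists_isRun hm ε, fstar,
    ⟨⟨y, hm.mem, hm.eq⟩, by rintro _ ⟨x, hx, rfl⟩; exact hm.le x hx⟩,
    fun s hs => ⟨fun k => ?_, fun ℓ hℓ => h.exists_optimal hD hm hε0 hs hℓ⟩⟩
  have hinv := h.inv_of_isRun hm hs k
  obtain ⟨α, -, -, hxp, -⟩ := hinv.ray
  exact ⟨⟨hinv.mem, hxp ▸ SubgradA.Data.map_rayX h hinv.map_x α⟩,
    hinv.le.trans_lt (EReal.coe_lt_top _)⟩
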